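/- Let $k \ge 0$ be a real number and let $A$, $B$, $C$ be qubits. Let $\Phi^k = |\Phi^k\rangle\langle\Phi^k|$ be the two-qubit resource state on $B\otimes C$ given by $|\Phi^k\rangle = \frac{1}{\sqrt{1+k^2}}\,(|00\rangle + k|11\rangle)$. Let $\mathrm{LOCC}(A\otimes B, C)$ be the set of completely positive, trace-nonincreasing superoperators on $A\otimes B\otimes C$ that are implementable by finitely many rounds of local (generalized, possibly postselected) measurements and operations on $A\otimes B$ and on $C$, coordinated by classical communication. For a two-qubit density operator $\rho$, the optimal sampling overhead of a wire cut of the single-qubit identity $\mathcal I$ with resource state $\rho$ is $$\gamma^{\rho}(\mathcal I) = \min\Big\{\sum_i |c_i| \;\Big|\; \mathcal V = \sum_i c_i \mathcal F_i \text{ (a finite sum)},\ c_i\in\mathbb R,\ \mathcal F_i\in \mathrm{LOCC}(A\otimes B, C),\ \operatorname{Tr}_{AB}[\mathcal V(\varphi_A\otimes\rho_{BC})] = \varphi \text{ for every density operator } \varphi \text{ of a qubit}\Big\},$$ where $\mathcal V$ ranges over the linear superoperators on $A\otimes B\otimes C$. Then, for the resource state $\rho = \Phi^k$, this minimum exists and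 $$\gamma^{\Phi^k}(\mathcal I) = \frac{4(k^2+1)}{(k+1)^2} - 1 .$$ -/

import Mathlib

open scoped Kronecker ComplexOrder

/-- The index set of the computational basis of a qubit. -/
abbrev Qubit : Type := Fin 2

/-- Superoperators (linear maps on operators) from the system with basis `m`
to the system with basis `n`. -/
abbrev Superop (m n : Type) : Type := Matrix m m ℂ →ₗ[ℂ] Matrix n n ℂ

/-- Density operators: positive semidefinite operators of unit trace. -/
def IsDensity {n : Type} [Fintype n] (φ : Matrix n n ℂ) : Prop :=
  φ.PosSemidef ∧ φ.trace = 1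

/-- The map `X ↦ M X M†` attached to a single Kraus (measurement) operator `M`. -/
def krausMap {m n : Type} [Fintype m] (M : Matrix n m ℂ) : Superop m n where
  toFun X := M * X * M.conjTranspose
  map_add' X Y := by rw [Matrix.mul_add, Matrix.add_mul]
  map_smul' c X := by
    rw [Matrix.mul_smul, Matrix.smul_mul, RingHom.id_apply]

/-- `IsLOCC A' B' A B F`: the superoperator `F`, from the bipartite system with sides `A`, `B` to
the bipartite system with sides `A'`, `B'`, is realised by a protocol of finitely many rounds of
local operations and classical communication.

In a round one of the two parties applies a generalized measurement, with Kraus operators `K j`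
satisfying `∑ j, (K j)† (K j) ≤ 1`, to its own side and sends the outcome `j` to the other party;
the protocol then continues in a way that may depend on `j`. A party may change the dimension of
its side (attach or discard ancillas). Every local quantum operation or instrument is of this form,
since the later rounds are free to ignore (part of) the outcome.
As the Kraus operators need only satisfy `≤ 1`, outcomes may be discarded, so `F` is completely
positive and trace-nonincreasing, and not necessarily trace-preserving. -/
inductive IsLOCC (A' B' : Type) [Fintype A'] [DecidableEq A'] [Fintype B'] [DecidableEq B'] :
    (A B : Type) → [Fintype A] → [DecidableEq A] → [Fintype B] → [DecidableEq B] →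
    Superop (A × B) (A' × B') → Prop
  /-- The protocol that does nothing. -/
  | done : IsLOCC A' B' A' B' LinearMap.id
  /-- The party holding the first side measures and communicates its outcome. -/
  | left {A B A₁ : Type} [Fintype A] [DecidableEq A] [Fintype B] [DecidableEq B]
      [Fintype A₁] [DecidableEq A₁] {r : ℕ} (K : Fin r → Matrix A₁ A ℂ)
      (hK : (1 - ∑ j, (K j).conjTranspose * K j).PosSemidef)
      (F : Fin r → Superop (A₁ × B) (A' × B')) (hF : ∀ j, IsLOCC A' B' A₁ B (F j)) :
      IsLOCC A' B' A B (∑ j, F j ∘ₗ krausMap (K j ⊗ₖ (1 : Matrix B B ℂ)))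
  /-- The party holding the second side measures and communicates its outcome. -/
  | right {A B B₁ : Type} [Fintype A] [DecidableEq A] [Fintype B] [DecidableEq B]
      [Fintype B₁] [DecidableEq B₁] {r : ℕ} (K : Fin r → Matrix B₁ B ℂ)
      (hK : (1 - ∑ j, (K j).conjTranspose * K j).PosSemidef)
      (F : Fin r → Superop (A × B₁) (A' × B')) (hF : ∀ j, IsLOCC A' B' A B₁ (F j)) :
      IsLOCC A' B' A B (∑ j, F j ∘ₗ krausMap ((1 : Matrix A A ℂ) ⊗ₖ K j))

/-- The set `LOCC(A, B)` of LOCC superoperators on operators on `A ⊗ B`. -/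
def LOCC (A B : Type) [Fintype A] [DecidableEq A] [Fintype B] [DecidableEq B] :
    Set (Superop (A × B) (A × B)) :=
  {F | IsLOCC A B A B F}

/-- The partial trace over the first tensor factor. -/
def partialTraceLeft {m n : Type} [Fintype m] (X : Matrix (m × n) (m × n) ℂ) : Matrix n n ℂ :=
  Matrix.of fun i j => ∑ a, X (a, i) (a, j)

/-- The joint state `φ_A ⊗ ρ_BC` of three qubits, with the qubits grouped as `(A ⊗ B) ⊗ C`. -/
def wireInput (φ : Matrix Qubit Qubit ℂ) (ρ : Matrix (Qubit × Qubit) (Qubit × Qubit) ℂ) :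
    Matrix ((Qubit × Qubit) × Qubit) ((Qubit × Qubit) × Qubit) ℂ :=
  Matrix.reindex (Equiv.prodAssoc Qubit Qubit Qubit).symm (Equiv.prodAssoc Qubit Qubit Qubit).symm
    (φ ⊗ₖ ρ)

/-- `V`, a superoperator on the three qubits `A`, `B`, `C`, acts as the identity from qubit `A` to
qubit `C` when supplied with the resource state `ρ` on `B ⊗ C`:
`Tr_AB [V (φ ⊗ ρ_BC)] = φ` for all states `φ`. -/
def ActsAsWire (ρ : Matrix (Qubit × Qubit) (Qubit × Qubit) ℂ)
    (V : Superop ((Qubit × Qubit) × Qubit) ((Qubit × Qubit) × Qubit)) : Prop :=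
  ∀ φ : Matrix Qubit Qubit ℂ, IsDensity φ → partialTraceLeft (V (wireInput φ ρ)) = φ

/-- The sampling overheads `∑ i, |c i|` of all wire cuts with resource state `ρ`, that is, of all
finite decompositions `V = ∑ i, c i • F i`, with `c i` real and `F i ∈ LOCC(A ⊗ B, C)`, of a
superoperator `V` that acts as the identity wire from `A` to `C`.
The optimal sampling overhead of a wire cut is the minimum of this set. -/
def wireCutOverheads (ρ : Matrix (Qubit × Qubit) (Qubit × Qubit) ℂ) : Set ℝ :=
  {s | ∃ (V : Superop ((Qubit × Qubit) × Qubit) ((Qubit × Qubit) × Qubit)) (r : ℕ)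
      (c : Fin r → ℝ) (F : Fin r → Superop ((Qubit × Qubit) × Qubit) ((Qubit × Qubit) × Qubit)),
      (∀ i, F i ∈ LOCC (Qubit × Qubit) Qubit) ∧ V = ∑ i, (c i : ℂ) • F i ∧
      ActsAsWire ρ V ∧ s = ∑ i, |c i|}

/-- The vector `|Φ^k⟩ = (|00⟩ + k |11⟩) / √(1 + k²)`. -/
noncomputable def phiKet (k : ℝ) : Qubit × Qubit → ℂ :=
  ((1 / Real.sqrt (1 + k ^ 2) : ℝ) : ℂ) • (Pi.single (0, 0) 1 + (k : ℂ) • Pi.single (1, 1) 1)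

/-- The density operator `Φ^k = |Φ^k⟩⟨Φ^k|`. -/
noncomputable def phiState (k : ℝ) : Matrix (Qubit × Qubit) (Qubit × Qubit) ℂ :=
  Matrix.vecMulVec (phiKet k) (star (phiKet k))

/-! The proof is linear programming duality. Feeding the resource state into a superoperator and
tracing out `A ⊗ B` is linear (`inducedMap`), and a valid wire cut is sent to the identity, because
density operators span all operators (`ActsAsWire.inducedMap_eq`).

Lower bound: the functional `wireWitness` takes the claimed value on the identity, and has modulus
at most 1 on everything that LOCC can induce from `Φ^k` (`wireWitness_inducedMap_of_mem_LOCC`), so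
every decomposition costs at least that value. Only separability of LOCC is used
(`IsLOCC.isSeparable`). The bound `-1` is trace nonincrease; the bound `1` is `wire_inequality`, a
Cauchy-Schwarz estimate for a single product Kraus operator.

Upper bound: teleportation through `Φ^k` is a mixture of the identity and one Pauli conjugation
(`inducedMap_teleport`), which rotated frames turn into `X` or `Y`. Measuring and preparing the
flipped outcome is the equal mixture of conjugation by `X` and by `Y`, so subtracting it removes
both errors. The witness equals 1 on the two teleportations and -1 on `measureFlip`, so the bounds
meet. -/

/-! ### Kraus maps, and separability of LOCC. -/

theorem krausMap_apply {m n : Type} [Fintype m] (M : Matrix n m ℂ) (X : Matrix m m ℂ) :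
    krausMap M X = M * X * M.conjTranspose := rfl

theorem krausMap_comp {l m n : Type} [Fintype l] [Fintype m] (M : Matrix n m ℂ)
    (N : Matrix m l ℂ) : krausMap M ∘ₗ krausMap N = krausMap (M * N) := by
  ext1 X
  simp only [LinearMap.comp_apply, krausMap_apply, Matrix.conjTranspose_mul, Matrix.mul_assoc]

theorem krausMap_one {m : Type} [Fintype m] [DecidableEq m] :
    krausMap (1 : Matrix m m ℂ) = LinearMap.id := by
  ext1 X
  simp [krausMap_apply]

/-- Tensoring on the right with the identity preserves the Kraus inequality. -/
theorem posSemidef_one_sub_sum_kronecker_one {A A₁ B : Type} [Fintype A] [DecidableEq A]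
    [Fintype A₁] [Fintype B] [DecidableEq B] {r : ℕ} {K : Fin r → Matrix A₁ A ℂ}
    (hK : (1 - ∑ j, (K j).conjTranspose * K j).PosSemidef) :
    (1 - ∑ j, (K j ⊗ₖ (1 : Matrix B B ℂ)).conjTranspose *
      (K j ⊗ₖ (1 : Matrix B B ℂ))).PosSemidef := by
  have e : 1 - ∑ j, (K j ⊗ₖ (1 : Matrix B B ℂ)).conjTranspose * (K j ⊗ₖ (1 : Matrix B B ℂ)) =
      (1 - ∑ j, (K j).conjTranspose * K j) ⊗ₖ (1 : Matrix B B ℂ) := by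
    rw [← Matrix.one_kronecker_one]
    ext ⟨a, b⟩ ⟨a', b'⟩
    simp only [Matrix.conjTranspose_kronecker, ← Matrix.mul_kronecker_mul,
      Matrix.conjTranspose_one, Matrix.mul_one, Matrix.sub_apply, Matrix.sum_apply,
      Matrix.kroneckerMap_apply, sub_mul, Finset.sum_mul]
  rw [e]
  exact hK.kronecker Matrix.PosSemidef.one

/-- Tensoring on the left with the identity preserves the Kraus inequality. -/
theorem posSemidef_one_sub_sum_one_kronecker {A B B₁ : Type} [Fintype A] [DecidableEq A]
    [Fintype B₁] [Fintype B] [DecidableEq B] {r : ℕ} {K : Fin r → Matrix B₁ B ℂ}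
    (hK : (1 - ∑ j, (K j).conjTranspose * K j).PosSemidef) :
    (1 - ∑ j, ((1 : Matrix A A ℂ) ⊗ₖ K j).conjTranspose *
      ((1 : Matrix A A ℂ) ⊗ₖ K j)).PosSemidef := by
  have e : 1 - ∑ j, ((1 : Matrix A A ℂ) ⊗ₖ K j).conjTranspose * ((1 : Matrix A A ℂ) ⊗ₖ K j) =
      (1 : Matrix A A ℂ) ⊗ₖ (1 - ∑ j, (K j).conjTranspose * K j) := by
    rw [← Matrix.one_kronecker_one]
    ext ⟨a, b⟩ ⟨a', b'⟩
    simp only [Matrix.conjTranspose_kronecker, ← Matrix.mul_kronecker_mul,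
      Matrix.conjTranspose_one, Matrix.mul_one, Matrix.sub_apply, Matrix.sum_apply,
      Matrix.kroneckerMap_apply, mul_sub, Finset.mul_sum]
  rw [e]
  exact Matrix.PosSemidef.one.kronecker hK

/-- Composing an instrument with instruments that depend on its outcome preserves the Kraus
inequality. -/
theorem posSemidef_one_sub_sum_sigma {l m n : Type} [Fintype l] [DecidableEq l] [Fintype m]
    [DecidableEq m] [Fintype n] {r : ℕ} {K : Fin r → Matrix m l ℂ}
    (hK : (1 - ∑ j, (K j).conjTranspose * K j).PosSemidef) {ι : Fin r → Type}
    [∀ j, Fintype (ι j)] {L : ∀ j, ι j → Matrix n m ℂ}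
    (hL : ∀ j, (1 - ∑ i, (L j i).conjTranspose * L j i).PosSemidef) :
    (1 - ∑ x : Σ j, ι j, (L x.1 x.2 * K x.1).conjTranspose * (L x.1 x.2 * K x.1)).PosSemidef := by
  -- Telescoping: `1 - ∑ K†L†LK = (1 - ∑ K†K) + ∑ K†(1 - ∑ L†L)K`.
  have h := hK.add (Matrix.posSemidef_sum Finset.univ
    fun j _ => (hL j).conjTranspose_mul_mul_same (K j))
  convert h using 1
  simp only [Fintype.sum_sigma, Matrix.conjTranspose_mul, Matrix.mul_sub, Matrix.sub_mul,
    Finset.sum_sub_distrib, Matrix.mul_one, Matrix.mul_sum, Matrix.sum_mul, Matrix.mul_assoc]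
  abel

theorem sum_linearMap_comp {l m n ι : Type} [Fintype ι] (F : ι → Superop m n) (G : Superop l m) :
    (∑ i, F i) ∘ₗ G = ∑ i, F i ∘ₗ G := by
  ext1 X
  simp only [LinearMap.comp_apply, LinearMap.sum_apply]

/-- `F` has a finite Kraus representation with product Kraus operators. -/
def IsSeparableOp {A' B' A B : Type} [Fintype A'] [Fintype B'] [Fintype A] [DecidableEq A]
    [Fintype B] [DecidableEq B] (F : Superop (A × B) (A' × B')) : Prop :=
  ∃ (ι : Type) (_ : Fintype ι) (M : ι → Matrix A' A ℂ) (N : ι → Matrix B' B ℂ),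
    (1 - ∑ i, (M i ⊗ₖ N i).conjTranspose * (M i ⊗ₖ N i)).PosSemidef ∧
      F = ∑ i, krausMap (M i ⊗ₖ N i)

/-- Each round multiplies every later Kraus operator by a local one, so products stay products; the
outcome histories of the protocol become the index set. -/
theorem IsLOCC.isSeparable {A' B' : Type} [Fintype A'] [DecidableEq A'] [Fintype B']
    [DecidableEq B'] {A B : Type} [Fintype A] [DecidableEq A] [Fintype B] [DecidableEq B]
    {F : Superop (A × B) (A' × B')} (h : IsLOCC A' B' A B F) : IsSeparableOp F := by
  induction h with
  | done =>
    refine ⟨Unit, inferInstance, fun _ => 1, fun _ => 1, ?_, ?_⟩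
    · simpa using Matrix.PosSemidef.zero
    · simp [krausMap_one]
  | left K hK F hF ih =>
    choose ι hι M N hMN hF' using ih
    refine ⟨Σ j, ι j, inferInstance, fun x => M x.1 x.2 * K x.1, fun x => N x.1 x.2, ?_, ?_⟩
    · have := posSemidef_one_sub_sum_sigma (posSemidef_one_sub_sum_kronecker_one hK) hMN
      simpa only [← Matrix.mul_kronecker_mul, Matrix.mul_one] using this
    · rw [Fintype.sum_sigma]
      refine Finset.sum_congr rfl fun j _ => ?_
      rw [hF' j, sum_linearMap_comp]
      refine Finset.sum_congr rfl fun i _ => ?_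
      rw [krausMap_comp, ← Matrix.mul_kronecker_mul, Matrix.mul_one]
  | right K hK F hF ih =>
    choose ι hι M N hMN hF' using ih
    refine ⟨Σ j, ι j, inferInstance, fun x => M x.1 x.2, fun x => N x.1 x.2 * K x.1, ?_, ?_⟩
    · have := posSemidef_one_sub_sum_sigma (posSemidef_one_sub_sum_one_kronecker hK) hMN
      simpa only [← Matrix.mul_kronecker_mul, Matrix.mul_one] using this
    · rw [Fintype.sum_sigma]
      refine Finset.sum_congr rfl fun j _ => ?_
      rw [hF' j, sum_linearMap_comp]
      refine Finset.sum_congr rfl fun i _ => ?_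
      rw [krausMap_comp, ← Matrix.mul_kronecker_mul, Matrix.mul_one]

/-- One-way protocols: the first party measures, the second one acts depending on the outcome. -/
theorem isLOCC_oneWay {A B : Type} [Fintype A] [DecidableEq A] [Fintype B] [DecidableEq B]
    {r s : ℕ} (K : Fin r → Matrix A A ℂ) (L : Fin r → Fin s → Matrix B B ℂ)
    (hK : (1 - ∑ j, (K j).conjTranspose * K j).PosSemidef)
    (hL : ∀ j, (1 - ∑ l, (L j l).conjTranspose * L j l).PosSemidef) :
    (∑ j, ∑ l, krausMap (K j ⊗ₖ L j l)) ∈ LOCC A B := by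
  have h := IsLOCC.left K hK _ fun j =>
    IsLOCC.right (A := A) (L j) (hL j) (fun _ => LinearMap.id) fun _ => IsLOCC.done
  have e : (∑ j, ∑ l, krausMap (K j ⊗ₖ L j l)) = ∑ j, (∑ l, LinearMap.id ∘ₗ
      krausMap ((1 : Matrix A A ℂ) ⊗ₖ L j l)) ∘ₗ krausMap (K j ⊗ₖ (1 : Matrix B B ℂ)) := by
    refine Finset.sum_congr rfl fun j _ => ?_
    rw [sum_linearMap_comp]
    refine Finset.sum_congr rfl fun l _ => ?_
    rw [LinearMap.id_comp, krausMap_comp, ← Matrix.mul_kronecker_mul, Matrix.one_mul,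
      Matrix.mul_one]
  rw [e]
  exact h

/-! ### The map induced from `A` to `C`. -/

/-- The superoperator `φ ↦ Tr_AB [F (φ ⊗ ρ_BC)]` from qubit `A` to qubit `C`. -/
def inducedMap (ρ : Matrix (Qubit × Qubit) (Qubit × Qubit) ℂ) :
    Superop ((Qubit × Qubit) × Qubit) ((Qubit × Qubit) × Qubit) →ₗ[ℂ] Superop Qubit Qubit where
  toFun F :=
    { toFun := fun φ => partialTraceLeft (F (wireInput φ ρ))
      map_add' := fun φ ψ => by
        have : wireInput (φ + ψ) ρ = wireInput φ ρ + wireInput ψ ρ := by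
          ext i j; simp [wireInput, add_mul]
        rw [this, map_add]
        ext i j; simp [partialTraceLeft, Finset.sum_add_distrib]
      map_smul' := fun c φ => by
        have : wireInput (c • φ) ρ = c • wireInput φ ρ := by
          ext i j; simp [wireInput, mul_assoc]
        rw [this, map_smul]
        ext i j; simp [partialTraceLeft, Finset.mul_sum] }
  map_add' F G := by
    ext1 φ; ext i j; simp [partialTraceLeft, Finset.sum_add_distrib]
  map_smul' c F := by
    ext1 φ; ext i j; simp [partialTraceLeft, Finset.mul_sum]

theorem inducedMap_apply (ρ : Matrix (Qubit × Qubit) (Qubit × Qubit) ℂ)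
    (F : Superop ((Qubit × Qubit) × Qubit) ((Qubit × Qubit) × Qubit)) (φ : Matrix Qubit Qubit ℂ) :
    inducedMap ρ F φ = partialTraceLeft (F (wireInput φ ρ)) := rfl

/-- The unnormalized Schmidt coefficients of `Φ^k`. -/
def schmidt (k : ℝ) : Qubit → ℝ := ![1, k]

/-- The operator from `A` to `C` obtained by applying `M ⊗ N` to `A ⊗ B ⊗ C` with the unnormalized
resource vector on `B ⊗ C`, and projecting `A ⊗ B` onto the basis vector `o`. -/
def transferOp (k : ℝ) (M : Matrix (Qubit × Qubit) (Qubit × Qubit) ℂ) (N : Matrix Qubit Qubit ℂ)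
    (o : Qubit × Qubit) : Matrix Qubit Qubit ℂ :=
  Matrix.of fun i a => ∑ b, M o (a, b) * N i b * (schmidt k b : ℂ)

theorem phiState_apply (k : ℝ) (b c b' c' : Qubit) :
    phiState k (b, c) (b', c') = (1 + k ^ 2 : ℂ)⁻¹ *
      ((if b = c then (schmidt k b : ℂ) else 0) * (if b' = c' then (schmidt k b' : ℂ) else 0)) := by
  have h : ((Real.sqrt (1 + k ^ 2) : ℝ) : ℂ)⁻¹ * ((Real.sqrt (1 + k ^ 2) : ℝ) : ℂ)⁻¹
      = (1 + k ^ 2 : ℂ)⁻¹ := by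
    rw [← mul_inv, ← Complex.ofReal_mul, Real.mul_self_sqrt (by positivity)]
    push_cast; rfl
  rw [← h]
  fin_cases b <;> fin_cases c <;> fin_cases b' <;> fin_cases c' <;>
    simp [phiState, phiKet, Matrix.vecMulVec_apply, schmidt] <;> ring

/-- The resource is pure, so the only new Kraus index comes from tracing out `A ⊗ B`; the factor in
front restores the normalization of `Φ^k`. -/
theorem inducedMap_krausMap (k : ℝ) (M : Matrix (Qubit × Qubit) (Qubit × Qubit) ℂ)
    (N : Matrix Qubit Qubit ℂ) :
    inducedMap (phiState k) (krausMap (M ⊗ₖ N)) =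
      (1 + k ^ 2 : ℂ)⁻¹ • ∑ o, krausMap (transferOp k M N o) := by
  ext1 φ
  ext i j
  simp only [inducedMap_apply, partialTraceLeft, Matrix.of_apply, LinearMap.smul_apply,
    LinearMap.sum_apply, Matrix.smul_apply, Matrix.sum_apply, smul_eq_mul, Finset.mul_sum]
  refine Finset.sum_congr rfl fun o _ => ?_
  simp only [krausMap_apply, Matrix.mul_apply, Fintype.sum_prod_type, Matrix.kroneckerMap_apply,
    Matrix.conjTranspose_apply, wireInput, Matrix.reindex_apply, Matrix.submatrix_apply,
    Equiv.symm_symm, Equiv.prodAssoc_apply, phiState_apply, transferOp, Matrix.of_apply,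
    Fin.sum_univ_two, star_add, star_mul', Complex.star_def, Complex.conj_ofReal, if_true]
  simp
  ring

/-- Four rank-one operators, proportional to eigenprojections of the Pauli matrices, already span
the 2 × 2 matrices, so agreement on states extends linearly. -/
theorem ActsAsWire.inducedMap_eq {ρ : Matrix (Qubit × Qubit) (Qubit × Qubit) ℂ}
    {V : Superop ((Qubit × Qubit) × Qubit) ((Qubit × Qubit) × Qubit)} (h : ActsAsWire ρ V) :
    inducedMap ρ V = LinearMap.id := by
  have key (v : Qubit → ℂ) (P : Matrix Qubit Qubit ℂ)
      (hv : ∀ i j, P i j = v i * star (v j)) (t : ℝ) (ht : 0 < t) (hP : P.trace = t) :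
      inducedMap ρ V P = P := by
    have hP' : P.PosSemidef := by
      have := Matrix.posSemidef_vecMulVec_self_star v
      convert this using 1
      ext i j
      rw [hv, Matrix.vecMulVec_apply, Pi.star_apply]
    have ht' : (t : ℂ) ≠ 0 := by exact_mod_cast ht.ne'
    have h1 : inducedMap ρ V ((t : ℂ)⁻¹ • P) = (t : ℂ)⁻¹ • P := by
      refine h _ ⟨hP'.smul ?_, ?_⟩
      · rw [← Complex.ofReal_inv, Complex.zero_le_real]
        exact (inv_pos.2 ht).le
      · rw [Matrix.trace_smul, hP, smul_eq_mul, inv_mul_cancel₀ ht']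
    rw [map_smul] at h1
    exact smul_right_injective _ (inv_ne_zero ht') h1
  have h0 := key ![1, 0] (Matrix.single 0 0 1)
    (by intro i j; fin_cases i <;> fin_cases j <;> simp) 1 one_pos (by simp)
  have h1 := key ![0, 1] (Matrix.single 1 1 1)
    (by intro i j; fin_cases i <;> fin_cases j <;> simp) 1 one_pos (by simp)
  have hp := key ![1, 1] !![1, 1; 1, 1]
    (by intro i j; fin_cases i <;> fin_cases j <;> simp) 2 two_pos
    (by simp [Matrix.trace]; norm_num)
  have hi := key ![1, Complex.I] !![1, -Complex.I; Complex.I, 1]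
    (by intro i j; fin_cases i <;> fin_cases j <;> simp) 2 two_pos
    (by simp [Matrix.trace]; norm_num)
  have e01 : Matrix.single (0 : Qubit) (1 : Qubit) (1 : ℂ) =
      (1 / 2 : ℂ) • !![1, 1; 1, 1] + (Complex.I / 2) • !![1, -Complex.I; Complex.I, 1] -
      ((1 + Complex.I) / 2) • (Matrix.single 0 0 1 + Matrix.single 1 1 1) := by
    ext i j
    fin_cases i <;> fin_cases j <;> simp
    · ring
    · linear_combination (1 / 2) * Complex.I_sq
    · linear_combination -(1 / 2) * Complex.I_sq
    · ring
  have e10 : Matrix.single (1 : Qubit) (0 : Qubit) (1 : ℂ) =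
      (1 / 2 : ℂ) • !![1, 1; 1, 1] - (Complex.I / 2) • !![1, -Complex.I; Complex.I, 1] -
      ((1 - Complex.I) / 2) • (Matrix.single 0 0 1 + Matrix.single 1 1 1) := by
    ext i j
    fin_cases i <;> fin_cases j <;> simp
    · ring
    · linear_combination -(1 / 2) * Complex.I_sq
    · linear_combination (1 / 2) * Complex.I_sq
    · ring
  have h01 : inducedMap ρ V (Matrix.single 0 1 1) = Matrix.single 0 1 1 := by
    rw [e01]; simp only [map_add, map_sub, map_smul, h0, h1, hp, hi]
  have h10 : inducedMap ρ V (Matrix.single 1 0 1) = Matrix.single 1 0 1 := by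
    rw [e10]; simp only [map_add, map_sub, map_smul, h0, h1, hp, hi]
  refine Matrix.ext_linearMap ℂ fun i j => LinearMap.ext_ring ?_
  fin_cases i <;> fin_cases j <;> simpa

/-! ### The dual witness. -/

/-- The linear functional that certifies the optimality of wire cuts with resource state `Φ^k`. -/
noncomputable def wireWitness (k : ℝ) : Superop Qubit Qubit →ₗ[ℂ] ℂ where
  toFun E := (((1 + k ^ 2) / (1 + k) ^ 2 : ℝ) : ℂ) *
      (∑ a, ∑ b, E (Matrix.single a b 1) a b) - 1 / 2 * ∑ a, (E (Matrix.single a a 1)).trace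
  map_add' E F := by
    simp only [LinearMap.add_apply, Matrix.add_apply, Matrix.trace_add, Finset.sum_add_distrib]
    ring
  map_smul' c E := by
    simp only [LinearMap.smul_apply, Matrix.smul_apply, Matrix.trace_smul, smul_eq_mul,
      ← Finset.mul_sum, RingHom.id_apply]
    ring

theorem wireWitness_id (k : ℝ) :
    wireWitness k LinearMap.id = ((4 * (k ^ 2 + 1) / (k + 1) ^ 2 - 1 : ℝ) : ℂ) := by
  simp [wireWitness, Fin.sum_univ_two]
  ring

/-- The value of the witness on the map with Kraus operator `Y`. -/
theorem wireWitness_krausMap (k : ℝ) (Y : Matrix Qubit Qubit ℂ) :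
    wireWitness k (krausMap Y) = (((1 + k ^ 2) / (1 + k) ^ 2 * Complex.normSq Y.trace -
      1 / 2 * ∑ i, ∑ a, Complex.normSq (Y i a) : ℝ) : ℂ) := by
  simp [wireWitness, krausMap_apply, Matrix.trace, Fin.sum_univ_two, Matrix.mul_apply,
    Complex.normSq_eq_conj_mul_self]
  ring

/-! ### The inequality for one product Kraus operator. -/

/-- The Cauchy-Schwarz inequality in the exterior square of `ℂ²`. -/
theorem normSq_det_le (x y u v : ℂ) : Complex.normSq (x * v - y * u) ≤
    (Complex.normSq x + Complex.normSq y) * (Complex.normSq u + Complex.normSq v) := by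
  have : (Complex.normSq x + Complex.normSq y) * (Complex.normSq u + Complex.normSq v) =
      Complex.normSq (x * v - y * u) +
      Complex.normSq (x * (starRingEnd ℂ) u + y * (starRingEnd ℂ) v) := by
    simp [Complex.normSq_apply]; ring
  rw [this]
  exact le_add_of_nonneg_right (Complex.normSq_nonneg _)

theorem normSq_dot_le (x y u v : ℂ) : Complex.normSq (x * u + y * v) ≤
    (Complex.normSq x + Complex.normSq y) * (Complex.normSq u + Complex.normSq v) := by
  have := normSq_det_le x y (-v) u
  simp only [Complex.normSq_neg] at this
  convert this using 2 <;> ring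

theorem two_mul_abs_re_mul_le {x y : ℂ} {a b c d : ℝ} (ha : 0 ≤ a) (hb : 0 ≤ b) (hc : 0 ≤ c)
    (hd : 0 ≤ d) (hx : Complex.normSq x ≤ a * d) (hy : Complex.normSq y ≤ b * c) :
    2 * |(x * y).re| ≤ a * c + b * d := by
  have h1 : (x * y).re ^ 2 ≤ (a * d) * (b * c) := by
    refine le_trans ?_ (mul_le_mul hx hy (Complex.normSq_nonneg _) (by positivity))
    rw [← Complex.normSq_mul, Complex.normSq_apply (x * y)]
    nlinarith [mul_self_nonneg (x * y).im]
  have h2 : |2 * (x * y).re| ≤ a * c + b * d := by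
    refine abs_le_of_sq_le_sq ?_ (by positivity)
    nlinarith [sq_nonneg (a * c - b * d)]
  rwa [abs_mul, abs_two] at h2

/-- The weight that certifies the bound on the witness. -/
noncomputable def wireWeight (k : ℝ) (b : Qubit) : ℝ :=
  2 * schmidt k b / (1 + k) - schmidt k b ^ 2 / (1 + k ^ 2)

theorem wireWeight_nonneg {k : ℝ} (hk : 0 ≤ k) (b : Qubit) : 0 ≤ wireWeight k b := by
  unfold wireWeight
  rw [sub_nonneg, div_le_div_iff₀ (by positivity) (by positivity)]
  fin_cases b
  · simp [schmidt]; nlinarith [sq_nonneg (k - 1)]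
  · simp [schmidt]; nlinarith [mul_nonneg hk (sq_nonneg (k - 1)), mul_nonneg hk (sq_nonneg k)]

/-- Both `schmidt k b / (1 + k)` and `schmidt k b ^ 2 / (1 + k ^ 2)` sum to 1 over `b`, and the
weight is twice the first minus the second. -/
theorem sum_wireWeight {k : ℝ} (hk : 0 ≤ k) : ∑ b, wireWeight k b = 1 := by
  have h1 : 1 + k ≠ 0 := by positivity
  have h2 : 1 + k ^ 2 ≠ 0 := by positivity
  simp [wireWeight, schmidt, Fin.sum_univ_two]
  field_simp
  ring

/-- The bound on the witness for a single operator `m₀ n₀ᵀ + k m₁ n₁ᵀ`, where `m_b = (x_b, y_b)`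
and `n_b = (u_b, v_b)`. -/
theorem wire_inequality {k : ℝ} (hk : 0 ≤ k) (x₀ y₀ x₁ y₁ u₀ v₀ u₁ v₁ : ℂ) :
    2 * Complex.normSq ((x₀ * u₀ + y₀ * v₀) + k * (x₁ * u₁ + y₁ * v₁)) ≤
      (1 + k) ^ 2 / (1 + k ^ 2) * (Complex.normSq (x₀ * u₀ + k * (x₁ * u₁)) +
        Complex.normSq (x₀ * v₀ + k * (x₁ * v₁)) + Complex.normSq (y₀ * u₀ + k * (y₁ * u₁)) +
        Complex.normSq (y₀ * v₀ + k * (y₁ * v₁))) +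
      (1 + k) ^ 2 *
      ((2 / (1 + k) - 1 / (1 + k ^ 2)) * ((Complex.normSq x₀ + Complex.normSq y₀) *
        (Complex.normSq u₀ + Complex.normSq v₀)) +
      (2 * k / (1 + k) - k ^ 2 / (1 + k ^ 2)) * ((Complex.normSq x₁ + Complex.normSq y₁) *
        (Complex.normSq u₁ + Complex.normSq v₁))) := by
  set P₀ := (Complex.normSq x₀ + Complex.normSq y₀) * (Complex.normSq u₀ + Complex.normSq v₀)
    with hP₀
  set P₁ := (Complex.normSq x₁ + Complex.normSq y₁) * (Complex.normSq u₁ + Complex.normSq v₁)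
    with hP₁
  have hg₀ := normSq_dot_le x₀ y₀ u₀ v₀
  have hg₁ := normSq_dot_le x₁ y₁ u₁ v₁
  rw [← hP₀] at hg₀
  rw [← hP₁] at hg₁
  set w₀ := x₀ * u₀ + y₀ * v₀
  set w₁ := x₁ * u₁ + y₁ * v₁
  set β := (w₀ * (starRingEnd ℂ) w₁).re with hβ
  set α := ((x₀ * (starRingEnd ℂ) x₁ + y₀ * (starRingEnd ℂ) y₁) *
    (u₀ * (starRingEnd ℂ) u₁ + v₀ * (starRingEnd ℂ) v₁)).re with hα
  have hβ2 : 2 * |β| ≤ P₀ + P₁ := by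
    have := two_mul_abs_re_mul_le (x := w₀) (y := (starRingEnd ℂ) w₁) (a := P₀) (b := P₁) (c := 1)
      (d := 1) ((Complex.normSq_nonneg _).trans hg₀) ((Complex.normSq_nonneg _).trans hg₁)
      zero_le_one zero_le_one (by simpa using hg₀) (by simpa [Complex.normSq_conj] using hg₁)
    rwa [mul_one, mul_one] at this
  have hαβ : 2 * |α - β| ≤ P₀ + P₁ := by
    have h1 := normSq_det_le x₀ y₀ ((starRingEnd ℂ) u₁) ((starRingEnd ℂ) v₁)
    have h2 := normSq_det_le ((starRingEnd ℂ) x₁) ((starRingEnd ℂ) y₁) u₀ v₀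
    simp only [Complex.normSq_conj] at h1 h2
    have h3 := two_mul_abs_re_mul_le
      (add_nonneg (Complex.normSq_nonneg x₀) (Complex.normSq_nonneg y₀))
      (add_nonneg (Complex.normSq_nonneg x₁) (Complex.normSq_nonneg y₁))
      (add_nonneg (Complex.normSq_nonneg u₀) (Complex.normSq_nonneg v₀))
      (add_nonneg (Complex.normSq_nonneg u₁) (Complex.normSq_nonneg v₁)) h1 h2
    -- The Binet-Cauchy identity in dimension two: the difference of products of inner products is a
    -- product of two determinants.
    have e : α - β = ((x₀ * (starRingEnd ℂ) v₁ - y₀ * (starRingEnd ℂ) u₁) *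
        ((starRingEnd ℂ) x₁ * v₀ - (starRingEnd ℂ) y₁ * u₀)).re := by
      rw [hα, hβ, ← Complex.sub_re]
      congr 1
      simp only [w₀, w₁, map_add, map_mul]
      ring
    rwa [e]
  have e₁ : Complex.normSq (w₀ + k * w₁) =
      Complex.normSq w₀ + k ^ 2 * Complex.normSq w₁ + 2 * k * β := by
    rw [hβ]
    simp [Complex.normSq_apply]
    ring
  have e₂ : Complex.normSq (x₀ * u₀ + k * (x₁ * u₁)) +
        Complex.normSq (x₀ * v₀ + k * (x₁ * v₁)) + Complex.normSq (y₀ * u₀ + k * (y₁ * u₁)) +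
        Complex.normSq (y₀ * v₀ + k * (y₁ * v₁)) = P₀ + k ^ 2 * P₁ + 2 * k * α := by
    rw [hα, hP₀, hP₁]
    simp [Complex.normSq_apply]
    ring
  rw [e₁, e₂]
  have hk1 : 0 < 1 + k := by positivity
  have hk2 : 0 < 1 + k ^ 2 := by positivity
  set σ := (1 + k) ^ 2 / (1 + k ^ 2) with hσ
  have hσ0 : 0 ≤ σ := by positivity
  have hσ2 : σ ≤ 2 := by
    rw [hσ, div_le_iff₀ hk2]
    nlinarith [sq_nonneg (k - 1)]
  -- The terms `-σ P₀` and `-k² σ P₁` cancel the diagonal part of the Hilbert-Schmidt term `σ (P₀ +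
  -- k² P₁ + 2kα)`; this is what dictates the form of the weights.
  have e₃ : (1 + k) ^ 2 * ((2 / (1 + k) - 1 / (1 + k ^ 2)) * P₀ +
      (2 * k / (1 + k) - k ^ 2 / (1 + k ^ 2)) * P₁) =
      (2 * (1 + k) - σ) * P₀ + (2 * k * (1 + k) - k ^ 2 * σ) * P₁ := by
    rw [hσ]
    field_simp
  rw [e₃]
  have h₁ : -(P₀ + P₁) ≤ 2 * (α - β) := by
    linarith [neg_abs_le (α - β)]
  have h₂ : -(P₀ + P₁) ≤ -(2 * β) := by
    linarith [le_abs_self β]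
  -- Write `σα - 2β = σ(α - β) - (2 - σ)β`. Since `0 ≤ σ ≤ 2`, the two bounds combine with weights
  -- `σ/2` and `1 - σ/2`.
  have h₃ : 0 ≤ k * (P₀ + P₁ + σ * α - 2 * β) := by
    refine mul_nonneg hk ?_
    nlinarith [mul_le_mul_of_nonneg_left h₁ hσ0,
      mul_le_mul_of_nonneg_left h₂ (sub_nonneg.2 hσ2)]
  have h₄ : 0 ≤ k ^ 2 * (P₁ - Complex.normSq w₁) :=
    mul_nonneg (sq_nonneg k) (sub_nonneg.2 hg₁)
  linarith

/-! ### The witness on LOCC, and the lower bound. -/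

/-- The value of the witness on an operator obtained from a product Kraus operator is bounded by
an expectation value of `(M ⊗ N)† (M ⊗ N)`. -/
theorem witness_transferOp_le {k : ℝ} (hk : 0 ≤ k)
    (M : Matrix (Qubit × Qubit) (Qubit × Qubit) ℂ) (N : Matrix Qubit Qubit ℂ) (o : Qubit × Qubit) :
    (1 + k ^ 2)⁻¹ * ((1 + k ^ 2) / (1 + k) ^ 2 * Complex.normSq (transferOp k M N o).trace -
      1 / 2 * ∑ i, ∑ a, Complex.normSq (transferOp k M N o i a)) ≤
    ∑ a, ∑ b, 1 / 2 * wireWeight k b * ∑ i, Complex.normSq (M o (a, b) * N i b) := by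
  have h := wire_inequality hk (M o (0, 0)) (M o (1, 0)) (M o (0, 1)) (M o (1, 1))
    (N 0 0) (N 1 0) (N 0 1) (N 1 1)
  have hk1 : 0 < 1 + k := by positivity
  have hk2 : 0 < 1 + k ^ 2 := by positivity
  have e₁ : (transferOp k M N o).trace = (M o (0, 0) * N 0 0 + M o (1, 0) * N 1 0) +
      k * (M o (0, 1) * N 0 1 + M o (1, 1) * N 1 1) := by
    simp [transferOp, Matrix.trace, Fin.sum_univ_two, schmidt]
    ring
  have e₂ (i a : Qubit) : transferOp k M N o i a =
      M o (a, 0) * N i 0 + k * (M o (a, 1) * N i 1) := by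
    simp [transferOp, Fin.sum_univ_two, schmidt]
    ring
  rw [e₁]
  simp only [e₂, Fin.sum_univ_two, Complex.normSq_mul, wireWeight]
  have e₃ : schmidt k 0 = 1 := rfl
  have e₄ : schmidt k 1 = k := rfl
  rw [e₃, e₄]
  refine le_of_mul_le_mul_left ?_ (show 0 < 2 * (1 + k) ^ 2 by positivity)
  refine le_trans (le_of_eq ?_) (le_trans (sub_le_sub_right h ((1 + k) ^ 2 / (1 + k ^ 2) *
    (Complex.normSq (M o (0, 0) * N 0 0 + k * (M o (0, 1) * N 0 1)) +
      Complex.normSq (M o (0, 0) * N 1 0 + k * (M o (0, 1) * N 1 1)) +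
      Complex.normSq (M o (1, 0) * N 0 0 + k * (M o (1, 1) * N 0 1)) +
      Complex.normSq (M o (1, 0) * N 1 0 + k * (M o (1, 1) * N 1 1))))) (le_of_eq ?_))
  · field_simp
    ring
  · ring

/-- The entries of `transferOp` are the amplitudes of `M ⊗ N` applied to `|a⟩ ⊗ (|00⟩ + k|11⟩)`, so
their squares sum to expectation values of `(M ⊗ N)†(M ⊗ N)`. -/
theorem sum_normSq_transferOp (k : ℝ) (M : Matrix (Qubit × Qubit) (Qubit × Qubit) ℂ)
    (N : Matrix Qubit Qubit ℂ) :
    ((∑ o, ∑ i, ∑ a, Complex.normSq (transferOp k M N o i a) : ℝ) : ℂ) =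
      ∑ a, ∑ b, ∑ b', (schmidt k b : ℂ) * schmidt k b' *
        ((M ⊗ₖ N).conjTranspose * (M ⊗ₖ N)) ((a, b), b) ((a, b'), b') := by
  simp [transferOp, Fin.sum_univ_two, Fintype.sum_prod_type, Matrix.mul_apply,
    Complex.normSq_eq_conj_mul_self]
  ring

theorem conjTranspose_mul_self_kronecker_diag (M : Matrix (Qubit × Qubit) (Qubit × Qubit) ℂ)
    (N : Matrix Qubit Qubit ℂ) (a b : Qubit) :
    ((M ⊗ₖ N).conjTranspose * (M ⊗ₖ N)) ((a, b), b) ((a, b), b) =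
      ((∑ o, ∑ i, Complex.normSq (M o (a, b) * N i b) : ℝ) : ℂ) := by
  simp only [Matrix.mul_apply, Matrix.conjTranspose_apply, Matrix.kroneckerMap_apply]
  rw [Fintype.sum_prod_type]
  push_cast
  simp only [Complex.normSq_eq_conj_mul_self, Complex.star_def]

theorem sum_normSq_kraus_diag_le {ι : Type} [Fintype ι]
    {M : ι → Matrix (Qubit × Qubit) (Qubit × Qubit) ℂ} {N : ι → Matrix Qubit Qubit ℂ}
    (h : (1 - ∑ i, (M i ⊗ₖ N i).conjTranspose * (M i ⊗ₖ N i)).PosSemidef) (a b : Qubit) :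
    ∑ i, ∑ o, ∑ c, Complex.normSq (M i o (a, b) * N i c b) ≤ 1 := by
  have h1 := h.diag_nonneg (i := ((a, b), b))
  rw [Matrix.sub_apply, Matrix.one_apply_eq, Matrix.sum_apply, sub_nonneg] at h1
  simp only [conjTranspose_mul_self_kronecker_diag] at h1
  exact_mod_cast h1

theorem sum_normSq_transferOp_le (k : ℝ) {ι : Type} [Fintype ι]
    {M : ι → Matrix (Qubit × Qubit) (Qubit × Qubit) ℂ} {N : ι → Matrix Qubit Qubit ℂ}
    (h : (1 - ∑ i, (M i ⊗ₖ N i).conjTranspose * (M i ⊗ₖ N i)).PosSemidef) :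
    ∑ i, ∑ o, ∑ c, ∑ a, Complex.normSq (transferOp k (M i) (N i) o c a) ≤ 2 * (1 + k ^ 2) := by
  set S := ∑ i, (M i ⊗ₖ N i).conjTranspose * (M i ⊗ₖ N i) with hS
  have h1 (a : Qubit) : ∑ b, ∑ b', (schmidt k b : ℂ) * schmidt k b' * S ((a, b), b) ((a, b'), b') ≤
      ((1 + k ^ 2 : ℝ) : ℂ) := by
    -- The test vector is `|a⟩ ⊗ (|00⟩ + k|11⟩)`, of squared norm `1 + k²`.
    have h2 := h.dotProduct_mulVec_nonneg
      (fun x => if x.1.1 = a ∧ x.1.2 = x.2 then (schmidt k x.2 : ℂ) else 0)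
    rw [Matrix.sub_mulVec, dotProduct_sub, sub_nonneg] at h2
    convert h2 using 1
    · fin_cases a <;>
        simp [Matrix.mulVec, dotProduct, Fintype.sum_prod_type, Fin.sum_univ_two] <;> ring
    · fin_cases a <;>
        simp [dotProduct, Fintype.sum_prod_type, Fin.sum_univ_two, schmidt] <;> ring
  have h2 := add_le_add (h1 0) (h1 1)
  have e : ((∑ i, ∑ o, ∑ c, ∑ a, Complex.normSq (transferOp k (M i) (N i) o c a) : ℝ) : ℂ) =
      (∑ b, ∑ b', (schmidt k b : ℂ) * schmidt k b' * S (((0 : Qubit), b), b) ((0, b'), b')) +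
      ∑ b, ∑ b', (schmidt k b : ℂ) * schmidt k b' * S (((1 : Qubit), b), b) ((1, b'), b') := by
    rw [Complex.ofReal_sum]
    simp only [sum_normSq_transferOp]
    simp only [hS, Matrix.sum_apply, Fin.sum_univ_two, Finset.mul_sum,
      Finset.sum_add_distrib]
    ring
  rw [← e, ← Complex.ofReal_add] at h2
  have h3 := Complex.real_le_real.1 h2
  linarith

theorem wireWitness_inducedMap_of_mem_LOCC {k : ℝ} (hk : 0 ≤ k)
    {F : Superop ((Qubit × Qubit) × Qubit) ((Qubit × Qubit) × Qubit)}
    (hF : F ∈ LOCC (Qubit × Qubit) Qubit) :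
    ∃ x : ℝ, wireWitness k (inducedMap (phiState k) F) = x ∧ |x| ≤ 1 := by
  obtain ⟨ι, _, M, N, h, rfl⟩ := IsLOCC.isSeparable hF
  refine ⟨∑ i, ∑ o, (1 + k ^ 2)⁻¹ * ((1 + k ^ 2) / (1 + k) ^ 2 *
    Complex.normSq (transferOp k (M i) (N i) o).trace -
      1 / 2 * ∑ c, ∑ a, Complex.normSq (transferOp k (M i) (N i) o c a)), ?_, abs_le.2 ⟨?_, ?_⟩⟩
  · rw [map_sum, map_sum, Complex.ofReal_sum]
    refine Finset.sum_congr rfl fun i _ => ?_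
    rw [inducedMap_krausMap, map_smul, map_sum, smul_eq_mul, Finset.mul_sum, Complex.ofReal_sum]
    refine Finset.sum_congr rfl fun o _ => ?_
    rw [wireWitness_krausMap, Complex.ofReal_mul]
    push_cast
    rfl
  · have h1 := sum_normSq_transferOp_le k h
    have hk2 : 0 < 1 + k ^ 2 := by positivity
    calc (-1 : ℝ) = (1 + k ^ 2)⁻¹ * (-(1 / 2) * (2 * (1 + k ^ 2))) := by field_simp
      _ ≤ (1 + k ^ 2)⁻¹ * (-(1 / 2) *
          ∑ i, ∑ o, ∑ c, ∑ a, Complex.normSq (transferOp k (M i) (N i) o c a)) :=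
        mul_le_mul_of_nonneg_left (by linarith) (inv_nonneg.2 hk2.le)
      _ ≤ _ := by
        rw [Finset.mul_sum, Finset.mul_sum]
        refine Finset.sum_le_sum fun i _ => ?_
        rw [Finset.mul_sum, Finset.mul_sum]
        refine Finset.sum_le_sum fun o _ => ?_
        refine mul_le_mul_of_nonneg_left ?_ (inv_nonneg.2 hk2.le)
        have : 0 ≤ (1 + k ^ 2) / (1 + k) ^ 2 *
            Complex.normSq (transferOp k (M i) (N i) o).trace :=
          mul_nonneg (by positivity) (Complex.normSq_nonneg _)
        linarith
  -- Only the diagonal entries of the Kraus inequality at the vectors `|a⟩|bb⟩` enter, averaged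
  -- uniformly over `a` and with the weights over `b`.
  · calc _ ≤ ∑ i, ∑ o, ∑ a, ∑ b,
          1 / 2 * wireWeight k b * ∑ c, Complex.normSq (M i o (a, b) * N i c b) :=
        Finset.sum_le_sum fun i _ => Finset.sum_le_sum fun o _ =>
          witness_transferOp_le hk (M i) (N i) o
      _ = ∑ a, ∑ b, 1 / 2 * wireWeight k b *
          ∑ i, ∑ o, ∑ c, Complex.normSq (M i o (a, b) * N i c b) := by
        simp only [Fin.sum_univ_two, mul_add, Finset.sum_add_distrib, Finset.mul_sum]
      _ ≤ ∑ _a : Qubit, ∑ b, 1 / 2 * wireWeight k b * 1 :=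
        Finset.sum_le_sum fun a _ => Finset.sum_le_sum fun b _ =>
          mul_le_mul_of_nonneg_left (sum_normSq_kraus_diag_le h a b)
            (mul_nonneg (by norm_num) (wireWeight_nonneg hk b))
      _ = 1 := by
        simp only [mul_one, ← Finset.mul_sum, sum_wireWeight hk]
        norm_num

/-- No wire cut with resource state `Φ^k` has a smaller overhead. -/
theorem le_of_mem_wireCutOverheads {k : ℝ} (hk : 0 ≤ k) {s : ℝ}
    (hs : s ∈ wireCutOverheads (phiState k)) : 4 * (k ^ 2 + 1) / (k + 1) ^ 2 - 1 ≤ s := by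
  obtain ⟨V, r, c, F, hF, hV, hwire, rfl⟩ := hs
  choose x hx hx1 using fun i => wireWitness_inducedMap_of_mem_LOCC hk (hF i)
  have h1 := wireWitness_id k
  -- The identity is replaced by the map induced by the decomposition, so that the witness
  -- distributes over its terms.
  rw [← hwire.inducedMap_eq, hV, map_sum, map_sum] at h1
  simp only [map_smul, hx, smul_eq_mul] at h1
  have h2 : ∑ i, c i * x i = 4 * (k ^ 2 + 1) / (k + 1) ^ 2 - 1 := by exact_mod_cast h1
  rw [← h2]
  refine Finset.sum_le_sum fun i _ => (le_abs_self _).trans ?_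
  rw [abs_mul]
  exact mul_le_of_le_one_right (abs_nonneg _) (hx1 i)

/-! ### Teleportation through `Φ^k`. -/

def pauliX : Matrix Qubit Qubit ℂ := !![0, 1; 1, 0]

def pauliY : Matrix Qubit Qubit ℂ := !![0, -Complex.I; Complex.I, 0]

def pauliZ : Matrix Qubit Qubit ℂ := !![1, 0; 0, -1]

/-- The Pauli corrections of the teleportation protocol. -/
def pauliCorrection : Fin 4 → Matrix Qubit Qubit ℂ := ![1, pauliX, pauliZ, pauliX * pauliZ]

/-- The Kraus operators, on the first side, of the Bell measurement with Bell basis rotated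
by `W`. -/
noncomputable def bellKraus (W : Matrix Qubit Qubit ℂ) (j : Fin 4) :
    Matrix (Qubit × Qubit) (Qubit × Qubit) ℂ :=
  Matrix.of fun o x => if o = (0, 0) then
    ((Real.sqrt 2 : ℝ) : ℂ)⁻¹ * star ((W * pauliCorrection j) x.1 x.2) else 0

theorem inv_sqrt_two_mul_self :
    ((Real.sqrt 2 : ℝ) : ℂ)⁻¹ * ((Real.sqrt 2 : ℝ) : ℂ)⁻¹ = 1 / 2 := by
  rw [← mul_inv, ← Complex.ofReal_mul, Real.mul_self_sqrt (by positivity)]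
  push_cast
  norm_num

/-- The teleportation protocol with Pauli frame rotated by `W`. -/
noncomputable def teleport (W : Matrix Qubit Qubit ℂ) :
    Superop ((Qubit × Qubit) × Qubit) ((Qubit × Qubit) × Qubit) :=
  ∑ j, ∑ _l : Fin 1, krausMap (bellKraus W j ⊗ₖ (W * pauliCorrection j))

theorem pauliCorrection_conjTranspose_mul_self (j : Fin 4) :
    (pauliCorrection j).conjTranspose * pauliCorrection j = 1 := by
  ext a b
  fin_cases j <;> fin_cases a <;> fin_cases b <;>
    simp [pauliCorrection, pauliX, pauliZ, Matrix.mul_apply, Fin.sum_univ_two]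

/-- For unitary `W` the matrices `W * pauliCorrection j`, divided by `√2`, form an orthonormal basis
of the 2 × 2 matrices; this is their completeness relation. -/
theorem sum_bellKraus {W : Matrix Qubit Qubit ℂ} (hW : W * W.conjTranspose = 1) :
    ∑ j, (bellKraus W j).conjTranspose * bellKraus W j = 1 := by
  have e (a a' : Qubit) : W a 0 * star (W a' 0) + W a 1 * star (W a' 1) =
      if a = a' then 1 else 0 := by
    have := congrFun (congrFun hW a) a'
    simpa [Matrix.mul_apply, Fin.sum_univ_two, Matrix.one_apply] using this
  have h (x y : Qubit × Qubit) (j : Fin 4) : ((bellKraus W j).conjTranspose * bellKraus W j) x y =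
      1 / 2 * ((W * pauliCorrection j) x.1 x.2 * star ((W * pauliCorrection j) y.1 y.2)) := by
    rw [← inv_sqrt_two_mul_self]
    simp [bellKraus, Matrix.mul_apply (M := Matrix.conjTranspose _)]
    ring
  ext ⟨a, b⟩ ⟨a', b'⟩
  rw [Matrix.sum_apply]
  simp only [h]
  have e' := e a a'
  have : (1 : Matrix (Qubit × Qubit) (Qubit × Qubit) ℂ) (a, b) (a', b') =
      (W a 0 * star (W a' 0) + W a 1 * star (W a' 1)) * if b = b' then 1 else 0 := by
    rw [e', Matrix.one_apply]
    by_cases h1 : a = a' <;> by_cases h2 : b = b' <;> simp [h1, h2]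
  rw [this]
  fin_cases b <;> fin_cases b' <;>
    simp [Fin.sum_univ_four, pauliCorrection, pauliX, pauliZ, Matrix.mul_apply,
      Fin.sum_univ_two] <;> ring

theorem teleport_mem_LOCC {W : Matrix Qubit Qubit ℂ} (hW : W * W.conjTranspose = 1) :
    teleport W ∈ LOCC (Qubit × Qubit) Qubit := by
  refine isLOCC_oneWay (bellKraus W) (fun j _ => W * pauliCorrection j) ?_ fun j => ?_
  · rw [sum_bellKraus hW, sub_self]
    exact Matrix.PosSemidef.zero
  · have hW' : W.conjTranspose * W = 1 := mul_eq_one_comm.1 hW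
    have : (W * pauliCorrection j).conjTranspose * (W * pauliCorrection j) = 1 := by
      rw [Matrix.conjTranspose_mul, Matrix.mul_assoc, ← Matrix.mul_assoc W.conjTranspose, hW',
        Matrix.one_mul, pauliCorrection_conjTranspose_mul_self]
    simp only [Finset.univ_unique, Finset.sum_singleton, this, sub_self]
    exact Matrix.PosSemidef.zero

theorem transferOp_bellKraus (k : ℝ) (W : Matrix Qubit Qubit ℂ) (j : Fin 4) (o : Qubit × Qubit) :
    transferOp k (bellKraus W j) (W * pauliCorrection j) o = if o = (0, 0) then
      ((Real.sqrt 2 : ℝ) : ℂ)⁻¹ • (W * (pauliCorrection j *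
        Matrix.diagonal (fun b => (schmidt k b : ℂ)) * (pauliCorrection j).conjTranspose) *
        W.conjTranspose) else 0 := by
  have e : W * (pauliCorrection j * Matrix.diagonal (fun b => (schmidt k b : ℂ)) *
      (pauliCorrection j).conjTranspose) * W.conjTranspose = (W * pauliCorrection j) *
        Matrix.diagonal (fun b => (schmidt k b : ℂ)) * (W * pauliCorrection j).conjTranspose := by
    simp only [Matrix.conjTranspose_mul, Matrix.mul_assoc]
  rw [e]
  ext i a
  split_ifs with h
  · rw [Matrix.smul_apply, Matrix.mul_apply, smul_eq_mul, Finset.mul_sum]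
    simp only [transferOp, Matrix.of_apply, bellKraus, if_pos h, Matrix.mul_diagonal,
      Matrix.conjTranspose_apply]
    refine Finset.sum_congr rfl fun b _ => ?_
    ring
  · simp [transferOp, bellKraus, h]

theorem krausMap_smul {m n : Type} [Fintype m] (c : ℂ) (M : Matrix n m ℂ) :
    krausMap (c • M) = (c * star c) • krausMap M := by
  ext1 X
  simp only [krausMap_apply, LinearMap.smul_apply, Matrix.conjTranspose_smul, Matrix.smul_mul,
    Matrix.mul_smul, smul_smul]
  rw [mul_comm]

/-- Teleportation through `Φ^k` is a Pauli channel. -/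
theorem inducedMap_teleport (k : ℝ) {W : Matrix Qubit Qubit ℂ} (hW : W * W.conjTranspose = 1) :
    inducedMap (phiState k) (teleport W) =
      ((1 + k) ^ 2 / (2 * (1 + k ^ 2)) : ℂ) • LinearMap.id +
      ((1 - k) ^ 2 / (2 * (1 + k ^ 2)) : ℂ) • krausMap (W * pauliZ * W.conjTranspose) := by
  have hk2 : (1 + k ^ 2 : ℂ) ≠ 0 := by
    have : (1 + k ^ 2 : ℝ) ≠ 0 := by positivity
    exact_mod_cast this
  -- The correction conjugates `D = diag(1, k)` to `D` (twice) or to `diag(k, 1)` (twice), that is,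
  -- to `(1 + k)/2 ± (1 - k)/2 · Z`; the cross terms cancel in the sum.
  have hZ : (1 + k ^ 2 : ℂ)⁻¹ • (1 / 2 : ℂ) • ∑ j, krausMap (pauliCorrection j *
        Matrix.diagonal (fun b => (schmidt k b : ℂ)) * (pauliCorrection j).conjTranspose) =
      ((1 + k) ^ 2 / (2 * (1 + k ^ 2)) : ℂ) • krausMap 1 +
      ((1 - k) ^ 2 / (2 * (1 + k ^ 2)) : ℂ) • krausMap pauliZ := by
    ext1 φ
    ext i j
    fin_cases i <;> fin_cases j <;>
      simp [-Matrix.cons_mul, krausMap_apply, Fin.sum_univ_four, pauliCorrection, pauliX, pauliZ,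
        Matrix.mul_apply, Fin.sum_univ_two, schmidt, Matrix.diagonal_apply] <;> field_simp <;> ring
  have hid : krausMap W ∘ₗ krausMap (1 : Matrix Qubit Qubit ℂ) ∘ₗ krausMap W.conjTranspose =
      LinearMap.id := by
    rw [krausMap_comp, krausMap_comp, Matrix.one_mul, hW, krausMap_one]
  have hconj (E : Matrix Qubit Qubit ℂ) : krausMap (W * E * W.conjTranspose) =
      krausMap W ∘ₗ krausMap E ∘ₗ krausMap W.conjTranspose := by
    rw [krausMap_comp, krausMap_comp, Matrix.mul_assoc]
  have h1 (j : Fin 4) : inducedMap (phiState k)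
      (krausMap (bellKraus W j ⊗ₖ (W * pauliCorrection j))) = krausMap W ∘ₗ
        ((1 + k ^ 2 : ℂ)⁻¹ • (1 / 2 : ℂ) • krausMap (pauliCorrection j *
        Matrix.diagonal (fun b => (schmidt k b : ℂ)) * (pauliCorrection j).conjTranspose)) ∘ₗ
        krausMap W.conjTranspose := by
    have h0 : krausMap (0 : Matrix Qubit Qubit ℂ) = 0 := by
      ext1 X
      simp [krausMap_apply]
    rw [inducedMap_krausMap]
    simp only [transferOp_bellKraus, apply_ite krausMap, h0, Finset.sum_ite_eq', Finset.mem_univ,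
      if_true]
    rw [krausMap_smul, hconj]
    have : ((Real.sqrt 2 : ℝ) : ℂ)⁻¹ * star ((Real.sqrt 2 : ℝ) : ℂ)⁻¹ = 1 / 2 := by
      rw [← inv_sqrt_two_mul_self]
      simp
    rw [this]
    simp only [LinearMap.comp_smul, LinearMap.smul_comp]
  simp only [teleport, Finset.univ_unique, Finset.sum_singleton, map_sum, h1]
  rw [hconj, ← hid]
  ext1 φ
  have h2 := congrArg (krausMap W) (LinearMap.congr_fun hZ (krausMap W.conjTranspose φ))
  simpa only [LinearMap.add_apply, LinearMap.smul_apply, LinearMap.comp_apply,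
    LinearMap.sum_apply, map_add, map_sum, map_smul, Finset.smul_sum] using h2

/-! ### Measuring and flipping. -/

/-- The protocol that measures qubit `A` in the computational basis and prepares the flipped outcome
on qubit `C`. -/
def measureFlip : Superop ((Qubit × Qubit) × Qubit) ((Qubit × Qubit) × Qubit) :=
  ∑ j : Fin 2, ∑ l : Fin 2, krausMap
    ((Matrix.single j j (1 : ℂ) ⊗ₖ (1 : Matrix Qubit Qubit ℂ)) ⊗ₖ Matrix.single (1 - j) l (1 : ℂ))

theorem measureFlip_mem_LOCC : measureFlip ∈ LOCC (Qubit × Qubit) Qubit := by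
  refine isLOCC_oneWay (fun j : Fin 2 => Matrix.single j j (1 : ℂ) ⊗ₖ (1 : Matrix Qubit Qubit ℂ))
    (fun j l => Matrix.single (1 - j) l (1 : ℂ)) ?_ fun j => ?_
  · refine posSemidef_one_sub_sum_kronecker_one ?_
    convert Matrix.PosSemidef.zero (n := Qubit) (R := ℂ) using 1
    ext a b
    fin_cases a <;> fin_cases b <;> simp [Fin.sum_univ_two]
  · convert Matrix.PosSemidef.zero (n := Qubit) (R := ℂ) using 1
    ext a b
    fin_cases j <;> fin_cases a <;> fin_cases b <;> simp [Fin.sum_univ_two]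

theorem inducedMap_measureFlip (k : ℝ) (φ : Matrix Qubit Qubit ℂ) :
    inducedMap (phiState k) measureFlip φ = !![φ 1 1, 0; 0, φ 0 0] := by
  have hk2 : (1 + k ^ 2 : ℂ) ≠ 0 := by
    have : (1 + k ^ 2 : ℝ) ≠ 0 := by positivity
    exact_mod_cast this
  simp only [measureFlip, map_sum, inducedMap_krausMap]
  ext i j
  fin_cases i <;> fin_cases j <;>
    simp [krausMap_apply, Fin.sum_univ_two, Fintype.sum_prod_type, transferOp, Matrix.mul_apply,
      Matrix.single_apply, schmidt] <;> field_simp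

/-! ### Rotated frames and the optimal decomposition. -/

/-- The unitary that maps the computational basis to the eigenbasis of `X`. -/
noncomputable def frameX : Matrix Qubit Qubit ℂ := ((1 + Complex.I) / 2) • !![1, 1; 1, -1]

/-- The unitary that maps the computational basis to the eigenbasis of `Y`. -/
noncomputable def frameY : Matrix Qubit Qubit ℂ :=
  ((1 + Complex.I) / 2) • !![1, 1; Complex.I, -Complex.I]

/-- The scalar `(1 + i)/2` has modulus `1/√2`: it normalizes the frames without a square root, and
its phase drops out under conjugation. -/
theorem frame_phase_mul_conj :
    (1 + Complex.I) / 2 * ((1 + -Complex.I) / 2) = 1 / 2 := by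
  linear_combination (-1 / 4) * Complex.I_sq

theorem frameX_unitary : frameX * frameX.conjTranspose = 1 := by
  ext i j
  simp only [frameX, Matrix.conjTranspose_smul, Matrix.smul_mul, Matrix.mul_smul, smul_smul]
  fin_cases i <;> fin_cases j <;> simp [-Matrix.cons_mul, Matrix.mul_apply, Fin.sum_univ_two] <;>
    linear_combination 2 * frame_phase_mul_conj

theorem frameY_unitary : frameY * frameY.conjTranspose = 1 := by
  ext i j
  simp only [frameY, Matrix.conjTranspose_smul, Matrix.smul_mul, Matrix.mul_smul, smul_smul]
  fin_cases i <;> fin_cases j <;> simp [-Matrix.cons_mul, Matrix.mul_apply, Fin.sum_univ_two] <;>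
    linear_combination 2 * frame_phase_mul_conj

theorem frameX_conj : frameX * pauliZ * frameX.conjTranspose = pauliX := by
  ext i j
  simp only [frameX, Matrix.conjTranspose_smul, Matrix.smul_mul, Matrix.mul_smul, smul_smul]
  fin_cases i <;> fin_cases j <;>
    simp [-Matrix.cons_mul, pauliX, pauliZ, Matrix.mul_apply, Fin.sum_univ_two] <;>
    linear_combination 2 * frame_phase_mul_conj

theorem frameY_conj : frameY * pauliZ * frameY.conjTranspose = pauliY := by
  ext i j
  simp only [frameY, Matrix.conjTranspose_smul, Matrix.smul_mul, Matrix.mul_smul, smul_smul]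
  fin_cases i <;> fin_cases j <;>
    simp [-Matrix.cons_mul, pauliY, pauliZ, Matrix.mul_apply, Fin.sum_univ_two] <;>
    first
      | linear_combination 2 * Complex.I * frame_phase_mul_conj
      | linear_combination 2 * Complex.I * frame_phase_mul_conj + Complex.I * Complex.I_sq

/-- The optimal wire cut: two rotated teleportation protocols, and measuring and flipping. -/
theorem mem_wireCutOverheads {k : ℝ} (hk : 0 ≤ k) :
    4 * (k ^ 2 + 1) / (k + 1) ^ 2 - 1 ∈ wireCutOverheads (phiState k) := by
  have hk1 : 0 < 1 + k := by positivity
  have hk2 : 0 < 1 + k ^ 2 := by positivity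
  have hc1 : (1 + k : ℂ) ≠ 0 := by exact_mod_cast hk1.ne'
  have hc2 : (1 + k ^ 2 : ℂ) ≠ 0 := by exact_mod_cast hk2.ne'
  -- Each teleportation has identity weight `(1 + k)² / (2(1 + k²))`, so the first coefficient makes
  -- each contribute one half of the identity. The last one cancels the remaining `X` and `Y`
  -- conjugations, each of weight `(1 - k)² / (2(1 + k)²)`.
  refine ⟨_, 3, ![(1 + k ^ 2) / (1 + k) ^ 2, (1 + k ^ 2) / (1 + k) ^ 2,
    -((1 - k) ^ 2 / (1 + k) ^ 2)], ![teleport frameX, teleport frameY, measureFlip],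
    ?_, rfl, ?_, ?_⟩
  · intro i
    fin_cases i
    · exact teleport_mem_LOCC frameX_unitary
    · exact teleport_mem_LOCC frameY_unitary
    · exact measureFlip_mem_LOCC
  · intro φ _
    rw [← inducedMap_apply]
    simp only [Fin.sum_univ_three, map_add, map_smul, LinearMap.add_apply, LinearMap.smul_apply,
      Matrix.cons_val_zero, Matrix.cons_val_one, Matrix.cons_val, inducedMap_measureFlip,
      inducedMap_teleport k frameX_unitary, inducedMap_teleport k frameY_unitary, frameX_conj,
      frameY_conj, LinearMap.id_apply, krausMap_apply]
    ext i j
    fin_cases i <;> fin_cases j <;>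
      simp [-Matrix.cons_mul, pauliX, pauliY, Matrix.mul_apply, Fin.sum_univ_two] <;> field_simp
    · linear_combination (-(1 - (k : ℂ)) ^ 2 * φ 1 1) * Complex.I_sq
    · linear_combination ((1 - (k : ℂ)) ^ 2 * φ 1 0) * Complex.I_sq
    · linear_combination ((1 - (k : ℂ)) ^ 2 * φ 0 1) * Complex.I_sq
    · linear_combination (-(1 - (k : ℂ)) ^ 2 * φ 0 0) * Complex.I_sq
  · have h1 : 0 ≤ (1 + k ^ 2) / (1 + k) ^ 2 := by positivity
    have h2 : 0 ≤ (1 - k) ^ 2 / (1 + k) ^ 2 := by positivity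
    simp only [Fin.sum_univ_three, Matrix.cons_val_zero, Matrix.cons_val_one, Matrix.cons_val,
      abs_neg, abs_of_nonneg h1, abs_of_nonneg h2]
    field_simp
    ring

theorem corollary1 (k : ℝ) (hk : 0 ≤ k) :
    IsLeast (wireCutOverheads (phiState k)) (4 * (k ^ 2 + 1) / (k + 1) ^ 2 - 1) :=
  ⟨mem_wireCutOverheads hk, fun _ hs => le_of_mem_wireCutOverheads hk hs⟩
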